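/- Let $G$ be a locally compact (Hausdorff) abelian group whose dual group $\hat G$ is arcwise connected and is a finite-dimensional Lie group (equivalently, $\hat G\cong\mathbb R^d\times\mathbb T^n$, $G\cong\mathbb R^d\times\mathbb Z^n$, for some $d,n\ge 0$). For a Borel probability measure $\mu$ on $G$ write $\hat\mu(\gamma)=\int_G\gamma(x)\,d\mu(x)$, $\gamma\in\hat G$, for its characteristic function, and let $$\Lambda^{\rm alg}(\mu)=\Big\{\tfrac mn:\ m,n\in\mathbb N,\ m,n\ge 1\text{ mutually prime, and there is a probability measure }\nu\text{ on }G\text{ with }\hat\mu^{\,m}=\hat\nu^{\,n}\Big\}.$$ Let $\mathcal N(\hat\mu)=\{\gamma\in\hat G:\hat\mu(\gamma)=0\}$ and, for $\gamma_0\in\hat G$, let $\mathcal P(\gamma_0)$ be the set of all smooth ($C^\infty$) paths $\alpha:(-1,1)\to\hat G$ with $\alpha(0)=\gamma_0$. Define $$t_0(\mu)=\sup_{\gamma_0\in\mathcal N(\hat\mu)}\ \sup_{\alpha\in\mathcal P(\gamma_0)}\ \sup\Big\{t\ge 0:\ \limsup_{s\to 0+}s^{-1}|\hat\mu(\alpha(s))|^t=\infty\Big\},$$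 with suprema taken in the extended reals and $0^0=1$. Theorem. Let $\mu$ be a probability measure on $G$ such that $\mathcal N(\hat\mu)\neq\emptyset$ and $\hat\mu$ is $C^3$ at $1\in\hat G$. Then $\Lambda^{\rm alg}(\mu)$ is bounded from below by $t_0(\mu)$, i.e. $\Lambda^{\rm alg}(\mu)\subseteq\mathbb Q\cap[t_0(\mu),\infty)$. -/

import Mathlib

open MeasureTheory Filter Topology
open scoped Manifold ContDiff

noncomputable section

namespace PartlyDivisible

variable {G : Type*} [CommGroup G] [TopologicalSpace G] [IsTopologicalGroup G]
  [MeasurableSpace G]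

/-- The characteristic function (Fourier transform) of a measure `μ` on the group `G`:
`γ ↦ ∫ γ(x) dμ(x)` for a character `γ` in the dual group. -/
def charFn (μ : Measure G) (γ : PontryaginDual G) : ℂ :=
  ∫ x, ((γ x : Circle) : ℂ) ∂μ

/-- The set of zeros of the characteristic function. -/
def zeroSet (μ : Measure G) : Set (PontryaginDual G) :=
  {γ | charFn μ γ = 0}

/-- The rational divisibility set: all positive rationals `m / n` (with `m, n ≥ 1` mutually prime)
for which the `m`-th power of the characteristic function of `μ` is the `n`-th power of the
characteristic function of a probability measure. -/
def LambdaAlg (μ : Measure G) : Set ℝ :=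
  {q | ∃ m n : ℕ, 0 < m ∧ 0 < n ∧ Nat.Coprime m n ∧ q = (m : ℝ) / (n : ℝ) ∧
    ∃ ν : Measure G, IsProbabilityMeasure ν ∧
      ∀ γ : PontryaginDual G, charFn μ γ ^ m = charFn ν γ ^ n}

variable (E : Type*) [NormedAddCommGroup E] [NormedSpace ℝ E]
  [ChartedSpace E (PontryaginDual G)]

/-- The smooth paths `α : (-1, 1) → Ĝ` with `α 0 = γ₀`; only the values of `α` on the interval
`(-1, 1)` matter. -/
def smoothPaths (γ₀ : PontryaginDual G) : Set (ℝ → PontryaginDual G) :=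
  {α | ContMDiffOn 𝓘(ℝ, ℝ) 𝓘(ℝ, E) ∞ α (Set.Ioo (-1) 1) ∧ α 0 = γ₀}

/-- The set of exponents `t ≥ 0` with `limsup_{s → 0+} s⁻¹ |μ̂(α(s))|^t = ∞`
(with the convention `0 ^ 0 = 1`). -/
def blowUpExponents (μ : Measure G) (α : ℝ → PontryaginDual G) : Set ℝ :=
  {t | 0 ≤ t ∧
    limsup (fun s : ℝ => ((s⁻¹ * ‖charFn μ (α s)‖ ^ t : ℝ) : EReal)) (𝓝[>] (0 : ℝ)) = ⊤}

/-- The supremum `t₀(μ)`, taken in the extended reals, over all zeros `γ₀` of the characteristic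
function and all smooth paths `α` through `γ₀`, of the exponents `t ≥ 0` with
`limsup_{s → 0+} s⁻¹ |μ̂(α(s))|^t = ∞`. -/
def tZero (μ : Measure G) : EReal :=
  ⨆ γ₀ ∈ zeroSet μ, ⨆ α ∈ smoothPaths E γ₀, ⨆ t ∈ blowUpExponents μ α, (t : EReal)

end PartlyDivisible

end

namespace PartlyDivisible

/-! Let `μ̂ ^ m = ν̂ ^ n` and `μ̂ γ₀ = 0`; then `ν̂ γ₀ = 0`, so `1, γ₀` are orthonormal in `L²(ν)`
and Bessel gives `|ν̂(γ)|² ≤ 1 - |ν̂(γ γ₀⁻¹)|²`. Bernoulli bounds the right side by `m (1 - |μ̂(γ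
γ₀⁻¹)|²)`, so regularity is needed only for `μ̂`. Since `|μ̂|²` is maximal at `1`, this is `O(s²)`
along a smooth path. Hence `|μ̂(α s)| ^ (m/n) = |ν̂(α s)| = O(s)`, which excludes blow-up for
exponents above `m/n`. -/

/-- A `C²` function with a local maximum at `0` drops at most quadratically to the right of `0`. -/
theorem exists_sub_le_mul_sq_of_isLocalMax {h : ℝ → ℝ} (hh : ContDiffAt ℝ 2 h 0)
    (hmax : IsLocalMax h 0) :
    ∃ C : ℝ, 0 ≤ C ∧ ∀ᶠ s in 𝓝[>] (0 : ℝ), h 0 - h s ≤ C * s ^ 2 := by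
  have hd0 : deriv h 0 = 0 := hmax.deriv_eq_zero
  have hd : DifferentiableAt ℝ (deriv h) 0 :=
    (ContDiffAt.derivWithin (m := 1) hh (by norm_num)).differentiableAt one_ne_zero
  obtain ⟨C, hCpos, hC⟩ := hd.isBigO_sub.exists_pos
  have hC' := hC.bound
  have hdiff : ∀ᶠ s in 𝓝 (0 : ℝ), DifferentiableAt ℝ h s := by
    filter_upwards [hh.eventually (by simp)] with s hs using hs.differentiableAt two_ne_zero
  obtain ⟨ε, hε, hball⟩ := Metric.eventually_nhds_iff.1 (hC'.and hdiff)
  refine ⟨C, hCpos.le, ?_⟩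
  filter_upwards [Ioo_mem_nhdsGT hε] with s hs
  have hb : ∀ y ∈ Set.Icc 0 s, |deriv h y| ≤ C * |y| ∧ DifferentiableAt ℝ h y := by
    intro y hy
    have := hball (y := y) (by
      rw [Real.dist_eq, sub_zero, abs_of_nonneg hy.1]; exact hy.2.trans_lt hs.2)
    simpa [hd0] using this
  obtain ⟨c, hc, hslope⟩ := exists_deriv_eq_slope h hs.1
    (fun y hy ↦ (hb y hy).2.continuousAt.continuousWithinAt)
    (fun y hy ↦ (hb y (Set.Ioo_subset_Icc_self hy)).2.differentiableWithinAt)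
  have hc' := (hb c (Set.Ioo_subset_Icc_self hc)).1
  rw [abs_of_pos hc.1] at hc'
  have hs0 : s - 0 ≠ 0 := by simpa using hs.1.ne'
  rw [eq_div_iff hs0, sub_zero] at hslope
  -- The mean value point satisfies `c < s`, so `|h'(c)| ≤ C c` becomes a bound by `C s`.
  have h1 : -(C * s) ≤ deriv h c := by
    have := neg_abs_le (deriv h c)
    nlinarith [hc.2]
  nlinarith [hs.1]

section CharFn

variable {G : Type*} [CommGroup G] [TopologicalSpace G] [MeasurableSpace G]

theorem integrable_character [BorelSpace G] (ν : Measure G) [IsFiniteMeasure ν] (γ : PontryaginDual G) :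
    Integrable (fun x ↦ ((γ x : Circle) : ℂ)) ν := by
  have hcont : Continuous fun x ↦ ((γ x : Circle) : ℂ) :=
    continuous_subtype_val.comp (map_continuous γ)
  exact .of_bound (C := 1) hcont.aestronglyMeasurable (ae_of_all _ fun x ↦ (Circle.norm_coe _).le)

theorem norm_charFn_le_one (ν : Measure G) [IsProbabilityMeasure ν] (γ : PontryaginDual G) :
    ‖charFn ν γ‖ ≤ 1 := by
  simpa [charFn] using norm_integral_le_of_norm_le_const (μ := ν) (C := 1)
    (f := fun x ↦ ((γ x : Circle) : ℂ)) (ae_of_all _ fun x ↦ (Circle.norm_coe _).le)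

theorem charFn_one (ν : Measure G) [IsProbabilityMeasure ν] : charFn ν 1 = 1 := by
  have : ∀ x, (1 : PontryaginDual G) x = 1 := fun _ ↦ rfl
  simp [charFn, this]

/-- Bessel's inequality in `L²(ν)` for the orthonormal family `1, γ₀`, applied to `γ`. -/
theorem norm_charFn_sq_add_norm_charFn_mul_inv_sq_le_one [BorelSpace G] (ν : Measure G)
    [IsProbabilityMeasure ν] {γ₀ : PontryaginDual G} (h₀ : charFn ν γ₀ = 0) (γ : PontryaginDual G) :
    ‖charFn ν γ‖ ^ 2 + ‖charFn ν (γ * γ₀⁻¹)‖ ^ 2 ≤ 1 := by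
  set a := charFn ν γ with ha
  set c := charFn ν (γ * γ₀⁻¹) with hc
  have hmul : ∀ (γ δ : PontryaginDual G) x, ((γ * δ) x : Circle) = γ x * δ x :=
    fun _ _ _ ↦ rfl
  have hinv : ∀ (γ : PontryaginDual G) x, (γ⁻¹) x = (γ x)⁻¹ := fun _ _ ↦ rfl
  have hI := integrable_character ν
  -- Residual of projecting `γ` onto the span of `1, γ₀`; the last cross term integrates to zero by
  -- `h₀`.
  have hpt : ∀ x, ‖((γ x : Circle) : ℂ) - a - c * (γ₀ x : Circle)‖ ^ 2 =
      1 + ‖a‖ ^ 2 + ‖c‖ ^ 2 - 2 * (starRingEnd ℂ a * (γ x : Circle)).re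
        - 2 * (starRingEnd ℂ c * ((γ * γ₀⁻¹) x : Circle)).re
        + 2 * (starRingEnd ℂ a * c * (γ₀ x : Circle)).re := by
    intro x
    rw [hmul, hinv, Circle.coe_mul, Circle.coe_inv_eq_conj]
    have h1 : Complex.normSq (γ x : Circle) = 1 := Circle.normSq_coe _
    have h2 : Complex.normSq (γ₀ x : Circle) = 1 := Circle.normSq_coe _
    simp only [← Complex.normSq_eq_norm_sq]
    simp only [Complex.normSq_apply, Complex.mul_re, Complex.mul_im, Complex.sub_re,
      Complex.sub_im, Complex.conj_re, Complex.conj_im] at h1 h2 ⊢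
    linear_combination h1 + (c.re * c.re + c.im * c.im) * h2
  have hre : ∀ (z : ℂ) (δ : PontryaginDual G),
      ∫ x, (z * (δ x : Circle)).re ∂ν = (z * charFn ν δ).re := by
    intro z δ
    rw [charFn, ← integral_const_mul]
    exact integral_re ((hI δ).const_mul z)
  have hJ : ∀ (z : ℂ) (δ : PontryaginDual G),
      Integrable (fun x ↦ 2 * (z * (δ x : Circle)).re) ν :=
    fun z δ ↦ ((hI δ).const_mul z).re.const_mul 2
  have hint : 0 ≤ ∫ x, ‖((γ x : Circle) : ℂ) - a - c * (γ₀ x : Circle)‖ ^ 2 ∂ν :=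
    integral_nonneg fun x ↦ by positivity
  simp_rw [hpt] at hint
  have hlin : ∀ {f g k : G → ℝ} (b : ℝ), Integrable f ν → Integrable g ν → Integrable k ν →
      ∫ x, b - f x - g x + k x ∂ν = b - ∫ x, f x ∂ν - ∫ x, g x ∂ν + ∫ x, k x ∂ν := by
    intro f g k b hf hg hk
    have hb : Integrable (fun _ : G ↦ b) ν := integrable_const b
    rw [integral_add (f := fun x ↦ b - f x - g x) ((hb.sub hf).sub hg) hk,
      integral_sub (f := fun x ↦ b - f x) (hb.sub hf) hg, integral_sub hb hf]
    simp
  rw [hlin _ (hJ _ _) (hJ _ _) (hJ _ _)] at hint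
  simp only [integral_const_mul, hre, h₀, ← ha, ← hc] at hint
  simp only [Complex.conj_mul', mul_zero,
    Complex.zero_re, add_zero, ← Complex.ofReal_pow, Complex.ofReal_re] at hint
  linarith

theorem norm_charFn_eq_rpow {μ ν : Measure G} {m n : ℕ} (hn : 0 < n) {γ : PontryaginDual G}
    (h : charFn μ γ ^ m = charFn ν γ ^ n) :
    ‖charFn ν γ‖ = ‖charFn μ γ‖ ^ ((m : ℝ) / n) := by
  have h' : ‖charFn μ γ‖ ^ m = ‖charFn ν γ‖ ^ n := by simpa using congrArg norm h
  rw [div_eq_mul_inv, Real.rpow_mul (norm_nonneg _), Real.rpow_natCast, h',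
    Real.pow_rpow_inv_natCast (norm_nonneg _) hn.ne']

/-- If `μ̂ ^ m = ν̂ ^ n`, then `1 - |ν̂|²` is controlled by `1 - |μ̂|²`. -/
theorem one_sub_norm_charFn_sq_le {μ ν : Measure G} [IsProbabilityMeasure μ]
    [IsProbabilityMeasure ν] {m n : ℕ} (hn : 0 < n) {γ : PontryaginDual G}
    (h : charFn μ γ ^ m = charFn ν γ ^ n) :
    1 - ‖charFn ν γ‖ ^ 2 ≤ m * (1 - ‖charFn μ γ‖ ^ 2) := by
  have h' : ‖charFn μ γ‖ ^ m = ‖charFn ν γ‖ ^ n := by simpa using congrArg norm h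
  have h1 : (‖charFn ν γ‖ ^ 2) ^ n ≤ ‖charFn ν γ‖ ^ 2 :=
    pow_le_of_le_one (by positivity) (pow_le_one₀ (norm_nonneg _) (norm_charFn_le_one ν γ)) hn.ne'
  rw [← pow_mul, mul_comm, pow_mul, ← h', ← pow_mul, mul_comm, pow_mul] at h1
  -- Bernoulli, after `1 - |ν̂|² ≤ 1 - |ν̂|^(2n) = 1 - |μ̂|^(2m)`.
  have h2 := one_add_mul_le_pow (a := ‖charFn μ γ‖ ^ 2 - 1)
    (by nlinarith [sq_nonneg ‖charFn μ γ‖]) m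
  rw [add_sub_cancel] at h2
  linarith

/-- As `|μ̂| ≤ 1`, raising the exponent beyond `q` only shrinks the power, so the quotient stays
below `C`. -/
theorem le_of_mem_blowUpExponents {μ : Measure G} [IsProbabilityMeasure μ]
    {α : ℝ → PontryaginDual G} {q C : ℝ} (hq : 0 ≤ q)
    (hC : ∀ᶠ s in 𝓝[>] (0 : ℝ), ‖charFn μ (α s)‖ ^ q ≤ C * s) {t : ℝ}
    (ht : t ∈ blowUpExponents μ α) : t ≤ q := by
  by_contra! hlt
  have hle : limsup (fun s : ℝ ↦ ((s⁻¹ * ‖charFn μ (α s)‖ ^ t : ℝ) : EReal)) (𝓝[>] (0 : ℝ)) ≤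
      (C : EReal) := by
    refine limsup_le_of_le (by isBoundedDefault) ?_
    filter_upwards [hC, self_mem_nhdsWithin] with s hs hs0
    have hs0 : 0 < s := hs0
    refine EReal.coe_le_coe_iff.2 ?_
    rw [inv_mul_le_iff₀ hs0, mul_comm s]
    -- At a zero of `μ̂`, monotonicity could fail only for `t = 0` (as `0 ^ 0 = 1`), excluded by `0
    -- ≤ q < t`.
    exact (Real.rpow_le_rpow_of_exponent_ge_of_imp (norm_nonneg _) (norm_charFn_le_one μ _) hlt.le
      fun _ h ↦ absurd h (hq.trans_lt hlt).ne').trans hs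
  rw [ht.2] at hle
  exact absurd (top_le_iff.1 hle) (EReal.coe_ne_top C)

end CharFn

section Path

variable {G : Type*} [CommGroup G] [TopologicalSpace G] [MeasurableSpace G]
  {E : Type*} [NormedAddCommGroup E] [NormedSpace ℝ E]
  [ChartedSpace E (PontryaginDual G)] [LieGroup 𝓘(ℝ, E) ∞ (PontryaginDual G)]

/-- Along a smooth path through a zero `γ₀`, the translate of `|μ̂|²` to the identity stays
quadratically close to `1`. -/
theorem exists_one_sub_norm_charFn_sq_le_mul_sq (μ : Measure G) [IsProbabilityMeasure μ]
    (hC3 : ContMDiffAt 𝓘(ℝ, E) 𝓘(ℝ, ℂ) 3 (charFn μ) 1) {γ₀ : PontryaginDual G}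
    {α : ℝ → PontryaginDual G} (hα : α ∈ smoothPaths E γ₀) :
    ∃ C : ℝ, 0 ≤ C ∧
      ∀ᶠ s in 𝓝[>] (0 : ℝ), 1 - ‖charFn μ (α s * γ₀⁻¹)‖ ^ 2 ≤ C * s ^ 2 := by
  obtain ⟨hsm, h0⟩ := hα
  have hα0 : ContMDiffAt 𝓘(ℝ, ℝ) 𝓘(ℝ, E) ∞ α 0 :=
    hsm.contMDiffAt (Ioo_mem_nhds (by norm_num) (by norm_num))
  have hβ : ContMDiffAt 𝓘(ℝ, ℝ) 𝓘(ℝ, E) ∞ (fun s ↦ α s * γ₀⁻¹) 0 :=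
    hα0.mul contMDiffAt_const
  have hβ0 : α 0 * γ₀⁻¹ = 1 := by rw [h0, mul_inv_cancel]
  have hf : ContMDiffAt 𝓘(ℝ, ℝ) 𝓘(ℝ, ℂ) 3 (fun s ↦ charFn μ (α s * γ₀⁻¹)) 0 := by
    refine ContMDiffAt.comp (I' := 𝓘(ℝ, E)) (0 : ℝ) (g := charFn μ)
      (f := fun s ↦ α s * γ₀⁻¹) ?_ (hβ.of_le (WithTop.coe_le_coe.2 (le_top (a := (3 : ℕ∞)))))
    rwa [hβ0]
  have hh : ContDiffAt ℝ 2 (fun s ↦ ‖charFn μ (α s * γ₀⁻¹)‖ ^ 2) 0 :=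
    (hf.contDiffAt.of_le (by norm_num)).norm_sq ℝ
  have hmax : IsLocalMax (fun s ↦ ‖charFn μ (α s * γ₀⁻¹)‖ ^ 2) 0 := by
    refine Eventually.of_forall fun s ↦ ?_
    simpa only [hβ0, charFn_one, norm_one, one_pow] using
      pow_le_one₀ (norm_nonneg _) (norm_charFn_le_one μ (α s * γ₀⁻¹))
  simpa only [hβ0, charFn_one, norm_one, one_pow] using
    exists_sub_le_mul_sq_of_isLocalMax hh hmax

/-- If `μ̂ ^ m = ν̂ ^ n`, then `ν̂` vanishes at least linearly along smooth paths through zeros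
of `μ̂`. -/
theorem exists_norm_charFn_le_mul [BorelSpace G] {μ ν : Measure G} [IsProbabilityMeasure μ]
    [IsProbabilityMeasure ν] {m n : ℕ} (hm : 0 < m) (hn : 0 < n)
    (hμν : ∀ γ : PontryaginDual G, charFn μ γ ^ m = charFn ν γ ^ n)
    (hC3 : ContMDiffAt 𝓘(ℝ, E) 𝓘(ℝ, ℂ) 3 (charFn μ) 1) {γ₀ : PontryaginDual G}
    (hγ₀ : γ₀ ∈ zeroSet μ) {α : ℝ → PontryaginDual G} (hα : α ∈ smoothPaths E γ₀) :
    ∃ C : ℝ, ∀ᶠ s in 𝓝[>] (0 : ℝ), ‖charFn ν (α s)‖ ≤ C * s := by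
  obtain ⟨C, hC, hev⟩ := exists_one_sub_norm_charFn_sq_le_mul_sq μ hC3 hα
  have hν₀ : charFn ν γ₀ = 0 := by
    have h := hμν γ₀
    rw [show charFn μ γ₀ = 0 from hγ₀, zero_pow hm.ne'] at h
    exact (pow_eq_zero_iff hn.ne').1 h.symm
  -- Factor `m` comes from Bernoulli, `C` from the quadratic bound; the root undoes the squares in
  -- Bessel.
  refine ⟨√(m * C), ?_⟩
  filter_upwards [hev, self_mem_nhdsWithin] with s hs hs0
  have hs0 : 0 < s := hs0
  refine abs_le_of_sq_le_sq' ?_ (by positivity) |>.2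
  rw [mul_pow, Real.sq_sqrt (by positivity)]
  have h1 := norm_charFn_sq_add_norm_charFn_mul_inv_sq_le_one ν hν₀ (α s)
  have h2 := one_sub_norm_charFn_sq_le hn (hμν (α s * γ₀⁻¹))
  have h3 := mul_le_mul_of_nonneg_left hs (Nat.cast_nonneg (α := ℝ) m)
  linarith

end Path

end PartlyDivisible

theorem theorem3p2
    {G : Type*} [CommGroup G] [TopologicalSpace G] [IsTopologicalGroup G]
    [LocallyCompactSpace G] [T2Space G] [MeasurableSpace G] [BorelSpace G]
    [PathConnectedSpace (PontryaginDual G)]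
    {E : Type*} [NormedAddCommGroup E] [NormedSpace ℝ E] [FiniteDimensional ℝ E]
    [ChartedSpace E (PontryaginDual G)] [LieGroup 𝓘(ℝ, E) ∞ (PontryaginDual G)]
    (μ : Measure G) [IsProbabilityMeasure μ]
    (hzero : (PartlyDivisible.zeroSet μ).Nonempty)
    (hC3 : ContMDiffAt 𝓘(ℝ, E) 𝓘(ℝ, ℂ) 3 (PartlyDivisible.charFn μ) 1) :
    PartlyDivisible.LambdaAlg μ ⊆
      Set.range ((↑) : ℚ → ℝ) ∩ {x : ℝ | PartlyDivisible.tZero E μ ≤ (x : EReal)} := by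
  rintro q ⟨m, n, hm, hn, -, rfl, ν, hν, hμν⟩
  refine ⟨⟨(m : ℚ) / n, by push_cast; rfl⟩, ?_⟩
  simp only [Set.mem_ofPred_eq, PartlyDivisible.tZero, iSup_le_iff]
  intro γ₀ hγ₀ α hα t ht
  obtain ⟨C, hC⟩ := PartlyDivisible.exists_norm_charFn_le_mul hm hn hμν hC3 hγ₀ hα
  simp only [PartlyDivisible.norm_charFn_eq_rpow hn (hμν _)] at hC
  exact EReal.coe_le_coe_iff.2 (PartlyDivisible.le_of_mem_blowUpExponents (by positivity) hC ht)
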